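/- An intersection representation of a finite simple graph $G$ by a class $\mathcal S$ of subsets of the Euclidean plane $\mathbb R^2$ is an assignment of a set $R_v \in \mathcal S$ to every vertex $v$ of $G$ such that, for any two distinct vertices $u, v$, the vertices $u$ and $v$ are adjacent if and only if $R_u \cap R_v \neq \emptyset$. An ellipse without its interior is an ellipse, of any centre, any orientation and any positive semi-axis lengths (circles included), regarded as a closed curve; a filled ellipse is an ellipse together with its interior. There is a finite simple graph $G$ that has an intersection representation by ellipses without their interior, but has no intersection representation by convex subsets of the plane. In particular, $G$ has no intersection representation by filled ellipses, so it is not true that every intersection graph of ellipses without interior is also an intersection graph of filled ellipses. -/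

import Mathlib

/-- The Euclidean plane. -/
abbrev Plane : Type := EuclideanSpace ℝ (Fin 2)

/-- The quadratic form `(x'/a)² + (y'/b)²`, where `(x', y')` are the coordinates of `p` in the
orthonormal frame with origin `c` that is rotated by the angle `θ`. -/
noncomputable def ellipseForm (c : Plane) (θ a b : ℝ) (p : Plane) : ℝ :=
  ((Real.cos θ * (p 0 - c 0) + Real.sin θ * (p 1 - c 1)) / a) ^ 2 +
    ((-Real.sin θ * (p 0 - c 0) + Real.cos θ * (p 1 - c 1)) / b) ^ 2

/-- `S` is an ellipse without its interior, that is, an ellipse as a closed curve: it has a centre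
`c`, semi-axes of positive lengths `a` and `b`, and an arbitrary orientation `θ`. Circles are the
case `a = b`. -/
def IsEllipse (S : Set Plane) : Prop :=
  ∃ (c : Plane) (θ a b : ℝ), 0 < a ∧ 0 < b ∧ S = {p | ellipseForm c θ a b p = 1}

/-- `S` is a filled ellipse, that is, an ellipse together with its interior. -/
def IsFilledEllipse (S : Set Plane) : Prop :=
  ∃ (c : Plane) (θ a b : ℝ), 0 < a ∧ 0 < b ∧ S = {p | ellipseForm c θ a b p ≤ 1}

/-- `G` has an intersection representation by plane sets with property `P`: every vertex is
represented by such a set, and two distinct vertices are adjacent exactly when their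
representatives have a common point. -/
def HasIntersectionRepresentation {V : Type*} (G : SimpleGraph V) (P : Set Plane → Prop) : Prop :=
  ∃ R : V → Set Plane, (∀ v, P (R v)) ∧ ∀ u v, u ≠ v → (G.Adj u v ↔ (R u ∩ R v).Nonempty)

/-! In `ovalGraph` two closed curves, the bodies, cross in four points. Four chains run between an
inner and an outer hub, and each meets both bodies; consecutive chains meet the bodies in opposite
orders. Each body can surround the inner hub as a curve, but convex sets cannot reproduce this.

Suppose there is a convex representation, and let a body `K` meet the disjoint sets `C 0, ..., C 3`
of its touching ellipses. A path in `K` from `C k` to `C (k + 2)` that avoids the other two would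
complete a planar drawing of `K₃,₃` (`oppositeSeparated_body`). So a segment of `K` between opposite
sets passes through exactly one of the other two, which yields two consecutive sides; applied to
both opposite pairs, it yields at least three of the four sides (`sides_of_oppositeSeparated`).
Hence the bodies have two sides in common (`two_common_sides`).

On a common side the alternating order forces the bodies to meet, again by `K₃,₃`
(`exists_crossing`). By convexity, the segment between meeting points on two different sides lies in
both bodies, so it misses every `C i`, the second body being disjoint from them. It is a shortcut in
`K` between opposite sets, a contradiction (`side_unique`).

The non-planarity of `K₃,₃` is proved by a parity count of logarithm increments
(`no_planar_drawing_K33`). -/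

/-! ### Variation of the logarithm along a path -/

/-- A nowhere vanishing continuous function on the plane has a continuous logarithm. -/
theorem exists_continuous_log_two_variables {F : ℝ × ℝ → ℂ} (hF : Continuous F)
    (h0 : ∀ x, F x ≠ 0) : ∃ L : ℝ × ℝ → ℂ, Continuous L ∧ ∀ x, Complex.exp (L x) = F x := by
  have hsc : IsSimplyConnected (Set.univ : Set (ℝ × ℝ)) := by
    have : ContractibleSpace (Set.univ : Set (ℝ × ℝ)) :=
      (convex_univ (𝕜 := ℝ)).contractibleSpace Set.univ_nonempty
    exact (inferInstance : SimplyConnectedSpace (Set.univ : Set (ℝ × ℝ)))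
  obtain ⟨L, hL, hexp⟩ := Complex.exists_continuousOn_eqOn_exp_comp hsc isOpen_univ
    hF.continuousOn (by rintro ⟨x, -, hx⟩; exact h0 x hx)
  exact ⟨L, continuousOn_univ.1 hL, fun x => hexp (Set.mem_univ x)⟩

open Classical in
/-- The increment over `[0, 1]` of a continuous logarithm of `f`. -/
noncomputable def logVariation (f : ℝ → ℂ) : ℂ :=
  if h : ∃ L : ℝ → ℂ, Continuous L ∧ ∀ t, Complex.exp (L t) = f t then
    h.choose 1 - h.choose 0 else 0

/-- Two continuous logarithms differ by a continuous integer multiple of `2πi`, hence by a constant,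
so the increment does not depend on the choice. -/
theorem logVariation_eq {f L : ℝ → ℂ} (hL : Continuous L) (hf : ∀ t, Complex.exp (L t) = f t) :
    logVariation f = L 1 - L 0 := by
  have h : ∃ L : ℝ → ℂ, Continuous L ∧ ∀ t, Complex.exp (L t) = f t := ⟨L, hL, hf⟩
  obtain ⟨hM, hMf⟩ := h.choose_spec
  rw [logVariation, dif_pos h]
  set M := h.choose
  have key : ∀ t, ∃ n : ℤ, M t - L t = n * (2 * Real.pi * Complex.I) := by
    intro t
    obtain ⟨n, hn⟩ := Complex.exp_eq_exp_iff_exists_int.1 ((hMf t).trans (hf t).symm)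
    exact ⟨n, by rw [hn]; ring⟩
  choose n hn using key
  have hpi : (2 * Real.pi * Complex.I : ℂ) ≠ 0 := Complex.two_pi_I_ne_zero
  have hcont : Continuous fun t => ((n t : ℤ) : ℂ) := by
    have : (fun t => ((n t : ℤ) : ℂ)) = fun t => (M t - L t) / (2 * Real.pi * Complex.I) := by
      funext t
      rw [hn, mul_div_cancel_right₀ _ hpi]
    rw [this]
    exact (hM.sub hL).div_const _
  have hn' : Continuous n := by
    have hemb : Topology.IsEmbedding (fun m : ℤ => (m : ℂ)) :=
      Complex.isClosedEmbedding_intCast.isEmbedding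
    exact hemb.continuous_iff.2 hcont
  have heq : n 1 = n 0 := PreconnectedSpace.constant inferInstance hn'
  have h1 := hn 1
  have h0 := hn 0
  rw [heq] at h1
  linear_combination h1 - h0

theorem exists_continuous_log {f : ℝ → ℂ} (hf : Continuous f) (h0 : ∀ t, f t ≠ 0) :
    ∃ L : ℝ → ℂ, Continuous L ∧ ∀ t, Complex.exp (L t) = f t := by
  obtain ⟨L, hL, hLf⟩ := exists_continuous_log_two_variables (F := fun x => f x.1)
    (hf.comp continuous_fst) fun x => h0 x.1
  exact ⟨fun t => L (t, 0), hL.comp (by fun_prop), fun t => hLf (t, 0)⟩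

theorem exp_logVariation {f : ℝ → ℂ} (hf : Continuous f) (h0 : ∀ t, f t ≠ 0) :
    Complex.exp (logVariation f) = f 1 / f 0 := by
  obtain ⟨L, hL, hLf⟩ := exists_continuous_log hf h0
  rw [logVariation_eq hL hLf, Complex.exp_sub, hLf, hLf]

theorem logVariation_neg {f : ℝ → ℂ} (hf : Continuous f) (h0 : ∀ t, f t ≠ 0) :
    logVariation (fun t => -f t) = logVariation f := by
  obtain ⟨L, hL, hLf⟩ := exists_continuous_log hf h0
  rw [logVariation_eq hL hLf, logVariation_eq (L := fun t => L t + Real.pi * Complex.I)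
    (by fun_prop) fun t => by rw [Complex.exp_add, hLf, Complex.exp_pi_mul_I]; ring]
  ring

/-- A global logarithm has zero total increment around the boundary of the unit square. With `F` the
difference of two disjoint edges, this is the only topological input to the non-planarity of `K₃,₃`.
-/
theorem logVariation_square {F : ℝ × ℝ → ℂ} (hF : Continuous F) (h0 : ∀ x, F x ≠ 0) :
    logVariation (fun s => F (s, 0)) + logVariation (fun t => F (1, t)) =
      logVariation (fun t => F (0, t)) + logVariation (fun s => F (s, 1)) := by
  obtain ⟨L, hL, hLF⟩ := exists_continuous_log_two_variables hF h0
  rw [logVariation_eq (L := fun s => L (s, 0)) (by fun_prop) fun s => hLF _,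
    logVariation_eq (L := fun t => L (1, t)) (by fun_prop) fun s => hLF _,
    logVariation_eq (L := fun t => L (0, t)) (by fun_prop) fun s => hLF _,
    logVariation_eq (L := fun s => L (s, 1)) (by fun_prop) fun s => hLF _]
  ring

/-! ### Non-planarity of `K₃,₃` -/

/-- Logarithms of the differences of distinct points, antisymmetric up to `π i`. -/
theorem exists_log_sub (A : Fin 3 → ℂ) (hA : ∀ i k, i ≠ k → A i ≠ A k) :
    ∃ a : Fin 3 → Fin 3 → ℂ, (∀ i k, i ≠ k → Complex.exp (a i k) = A i - A k) ∧
      ∀ i k, i < k → a k i = a i k + Real.pi * Complex.I := by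
  refine ⟨fun i k => if i < k then Complex.log (A i - A k)
    else Complex.log (A k - A i) + Real.pi * Complex.I, fun i k hik => ?_, fun i k hik => ?_⟩
  · dsimp only
    split_ifs with h
    · exact Complex.exp_log (sub_ne_zero.2 (hA i k hik))
    · rw [Complex.exp_add, Complex.exp_log (sub_ne_zero.2 (hA k i hik.symm)),
        Complex.exp_pi_mul_I]
      ring
  · simp [hik, not_lt.2 hik.le]

/-- `K₃,₃` has no drawing in the plane in which independent edges are disjoint. -/
theorem no_planar_drawing_K33 (A B : Fin 3 → ℂ) (E : Fin 3 → Fin 3 → ℝ → ℂ)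
    (hE : ∀ i j, Continuous (E i j)) (h0 : ∀ i j, E i j 0 = A i) (h1 : ∀ i j, E i j 1 = B j)
    (hd : ∀ i j k l, i ≠ k → j ≠ l → ∀ s t, E i j s ≠ E k l t) : False := by
  have other : ∀ j : Fin 3, ∃ l, j ≠ l := by decide
  have hA : ∀ i k, i ≠ k → A i ≠ A k := by
    intro i k hik
    rw [← h0 i 0, ← h0 k 1]
    exact hd _ _ _ _ hik (by decide) _ _
  have hB : ∀ j l, j ≠ l → B j ≠ B l := by
    intro j l hjl
    rw [← h1 0 j, ← h1 1 l]
    exact hd _ _ _ _ (by decide) hjl _ _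
  have hBA : ∀ j k, B j - A k ≠ 0 := by
    intro j k
    obtain ⟨i, hi⟩ := other k
    obtain ⟨l, hl⟩ := other j
    rw [← h1 i j, ← h0 k l]
    exact sub_ne_zero.2 (hd _ _ _ _ hi.symm hl _ _)
  have hEA : ∀ i j k, i ≠ k → ∀ s, E i j s - A k ≠ 0 := by
    intro i j k hik s
    obtain ⟨l, hl⟩ := other j
    rw [← h0 k l]
    exact sub_ne_zero.2 (hd _ _ _ _ hik hl _ _)
  have hEB : ∀ i j l, j ≠ l → ∀ s, E i j s - B l ≠ 0 := by
    intro i j l hjl s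
    obtain ⟨k, hk⟩ := other i
    rw [← h1 k l]
    exact sub_ne_zero.2 (hd _ _ _ _ hk hjl _ _)
  obtain ⟨a, ha, ha'⟩ := exists_log_sub A hA
  obtain ⟨b, hb, hb'⟩ := exists_log_sub B hB
  -- The integers `n` and `m` measure the increments along an edge, seen from a vertex off it,
  -- against fixed logarithms of the vertex differences. The value 0 for `i = k` is a dummy.
  have hn : ∀ i j k, ∃ n : ℤ, i ≠ k → logVariation (fun s => E i j s - A k) =
      Complex.log (B j - A k) - a i k + n * (2 * Real.pi * Complex.I) := by
    intro i j k
    by_cases hik : i = k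
    · exact ⟨0, fun h => absurd hik h⟩
    have hexp := exp_logVariation (f := fun s => E i j s - A k)
      ((hE i j).sub continuous_const) (hEA i j k hik)
    rw [h0, h1, ← ha i k hik] at hexp
    rw [← Complex.exp_log (hBA j k), ← Complex.exp_sub, Complex.exp_eq_exp_iff_exists_int] at hexp
    obtain ⟨n, hn⟩ := hexp
    exact ⟨n, fun _ => hn⟩
  -- The logarithm of `A i - B l` is taken as that of `B l - A i` plus `πi`, so that the mixed terms
  -- cancel in `hsq`.
  have hm : ∀ i j l, ∃ m : ℤ, j ≠ l → logVariation (fun s => E i j s - B l) =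
      b j l - (Complex.log (B l - A i) + Real.pi * Complex.I) + m * (2 * Real.pi * Complex.I) := by
    intro i j l
    by_cases hjl : j = l
    · exact ⟨0, fun h => absurd hjl h⟩
    have hexp := exp_logVariation (f := fun s => E i j s - B l)
      ((hE i j).sub continuous_const) (hEB i j l hjl)
    have hAB : A i - B l = Complex.exp (Complex.log (B l - A i) + Real.pi * Complex.I) := by
      rw [Complex.exp_add, Complex.exp_log (hBA l i), Complex.exp_pi_mul_I]
      ring
    rw [h0, h1, ← hb j l hjl, hAB, ← Complex.exp_sub, Complex.exp_eq_exp_iff_exists_int] at hexp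
    obtain ⟨n, hn⟩ := hexp
    exact ⟨n, fun _ => hn⟩
  choose n hn using hn
  choose m hm using hm
  have hsq : ∀ i j k l, i ≠ k → j ≠ l →
      logVariation (fun s => E i j s - A k) + logVariation (fun t => E k l t - B j) =
        logVariation (fun t => E k l t - A i) + logVariation (fun s => E i j s - B l) := by
    intro i j k l hik hjl
    have h := logVariation_square (F := fun x => E i j x.1 - E k l x.2)
      (((hE i j).comp continuous_fst).sub ((hE k l).comp continuous_snd))
      fun x => sub_ne_zero.2 (hd i j k l hik hjl _ _)
    simp only [h0, h1] at h
    have hj := logVariation_neg (f := fun t => E k l t - B j)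
      ((hE k l).sub continuous_const) (hEB k l j hjl.symm)
    have hi := logVariation_neg (f := fun t => E k l t - A i)
      ((hE k l).sub continuous_const) (hEA k l i hik.symm)
    simp only [neg_sub] at hi hj
    rw [← hi, ← hj]
    exact h
  have hpi : (Real.pi * Complex.I : ℂ) ≠ 0 := by simp [Real.pi_ne_zero]
  -- Exchanging the indices of `a` and of `b` contributes `πi` each. The two add up to `2πi` when
  -- the orders agree, and cancel in `hgt` when they disagree.
  have hlt : ∀ i k j l, i < k → j < l →
      n k l i + m i j l - n i j k - m k l j = 1 := by
    intro i k j l hik hjl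
    have h := hsq i j k l hik.ne hjl.ne
    rw [hn i j k hik.ne, hn k l i hik.ne', hm i j l hjl.ne, hm k l j hjl.ne',
      ha' i k hik, hb' j l hjl] at h
    have : ((n k l i + m i j l - n i j k - m k l j : ℤ) : ℂ) * (Real.pi * Complex.I) =
        (1 : ℤ) * (Real.pi * Complex.I) := by
      push_cast
      linear_combination -h / 2
    exact_mod_cast mul_right_cancel₀ hpi this
  have hgt : ∀ i k j l, i < k → l < j →
      n k l i + m i j l - n i j k - m k l j = 0 := by
    intro i k j l hik hjl
    have h := hsq i j k l hik.ne hjl.ne'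
    rw [hn i j k hik.ne, hn k l i hik.ne', hm i j l hjl.ne', hm k l j hjl.ne,
      ha' i k hik, hb' l j hjl] at h
    have : ((n k l i + m i j l - n i j k - m k l j : ℤ) : ℂ) * (Real.pi * Complex.I) =
        (0 : ℤ) * (Real.pi * Complex.I) := by
      push_cast
      linear_combination -h / 2
    exact_mod_cast mul_right_cancel₀ hpi this
  have e1 := hlt 0 1 0 1 (by decide) (by decide)
  have e2 := hlt 0 1 0 2 (by decide) (by decide)
  have e3 := hlt 0 1 1 2 (by decide) (by decide)
  have e4 := hlt 0 2 0 1 (by decide) (by decide)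
  have e5 := hlt 0 2 0 2 (by decide) (by decide)
  have e6 := hlt 0 2 1 2 (by decide) (by decide)
  have e7 := hlt 1 2 0 1 (by decide) (by decide)
  have e8 := hlt 1 2 0 2 (by decide) (by decide)
  have e9 := hlt 1 2 1 2 (by decide) (by decide)
  have f1 := hgt 0 1 1 0 (by decide) (by decide)
  have f2 := hgt 0 1 2 0 (by decide) (by decide)
  have f3 := hgt 0 1 2 1 (by decide) (by decide)
  have f4 := hgt 0 2 1 0 (by decide) (by decide)
  have f5 := hgt 0 2 2 0 (by decide) (by decide)
  have f6 := hgt 0 2 2 1 (by decide) (by decide)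
  have f7 := hgt 1 2 1 0 (by decide) (by decide)
  have f8 := hgt 1 2 2 0 (by decide) (by decide)
  have f9 := hgt 1 2 2 1 (by decide) (by decide)
  -- Each `n` and each `m` occurs in exactly two of the 18 equations, so the left sides have an even
  -- sum, while the right sides sum to 9.
  omega

/-- Set version of the non-planarity of `K₃,₃`. -/
theorem no_planar_drawing_K33_sets (A B : Fin 3 → Plane) (S : Fin 3 → Fin 3 → Set Plane)
    (hS : ∀ i j, JoinedIn (S i j) (A i) (B j))
    (hd : ∀ i j k l, i < k → j ≠ l → Disjoint (S i j) (S k l)) : False := by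
  let φ : Plane → ℂ := fun p => p 0 + p 1 * Complex.I
  have hφ : Continuous φ := by fun_prop
  have hinj : Function.Injective φ := by
    intro p q h
    have hre := congrArg Complex.re h
    have him := congrArg Complex.im h
    ext i
    fin_cases i
    · simpa [φ] using hre
    · simpa [φ] using him
  choose γ hγ using hS
  refine no_planar_drawing_K33 (φ ∘ A) (φ ∘ B) (fun i j t => φ ((γ i j).extend t))
    (fun i j => hφ.comp (γ i j).continuous_extend) (by simp) (by simp) ?_
  have hmem : ∀ i j t, (γ i j).extend t ∈ S i j := by
    intro i j t
    have : (γ i j).extend t ∈ Set.range (γ i j) := by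
      rw [← Path.extend_range]
      exact Set.mem_range_self t
    obtain ⟨x, hx⟩ := this
    exact hx ▸ hγ i j x
  intro i j k l hik hjl s t h
  have h := hinj h
  have h2 := hmem k l t
  rcases lt_or_gt_of_ne hik with hlt | hlt
  · exact Set.disjoint_left.1 (hd i j k l hlt hjl) (hmem i j s) (h ▸ h2)
  · exact Set.disjoint_left.1 (hd k l i j hlt hjl.symm) h2 (h ▸ hmem i j s)

/-! ### Convex sets meeting four disjoint convex sets -/

theorem joinedIn_of_segment_subset {x y : Plane} {S : Set Plane} (h : segment ℝ x y ⊆ S) :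
    JoinedIn S x y :=
  (((convex_segment x y).isPathConnected ⟨x, left_mem_segment ℝ x y⟩).joinedIn x
    (left_mem_segment ℝ x y) y (right_mem_segment ℝ x y)).mono h

/-- A segment of `K` joins `C i` to `C (i + 1)` and avoids the two other sets `C j`. -/
def HasSide (K : Set Plane) (C : Fin 4 → Set Plane) (i : Fin 4) : Prop :=
  ∃ x ∈ K ∩ C i, ∃ y ∈ K ∩ C (i + 1),
    Disjoint (segment ℝ x y) (C (i + 2)) ∧ Disjoint (segment ℝ x y) (C (i + 3))

/-- No path of `K` joins opposite sets `C k` and `C (k + 2)` without meeting one of the others. -/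
def OppositeSeparated (K : Set Plane) (C : Fin 4 → Set Plane) : Prop :=
  ∀ k, ∀ x ∈ K ∩ C k, ∀ y ∈ K ∩ C (k + 2), ¬ JoinedIn (K \ (C (k + 1) ∪ C (k + 3))) x y

theorem fin_four_add (k : Fin 4) : k + 1 + 1 = k + 2 ∧ k + 1 + 2 = k + 3 ∧ k + 1 + 3 = k ∧
    k + 3 + 1 = k ∧ k + 3 + 2 = k + 1 ∧ k + 3 + 3 = k + 2 ∧ k + 2 + 1 = k + 3 ∧ k + 2 + 2 = k ∧
    k + 2 + 3 = k + 1 := by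
  revert k; decide

theorem fin_four_add_ne (k : Fin 4) :
    k + 1 ≠ k + 3 ∧ k + 1 ≠ k ∧ k + 1 ≠ k + 2 ∧ k + 3 ≠ k ∧ k + 3 ≠ k + 2 := by
  revert k; decide

/-- A segment of `K` from `C k` to `C (k + 2)` must meet `C (k + 1)` or `C (k + 3)`, and cannot meet
both. A point where it meets one of them cuts it into two sides. -/
theorem sides_of_oppositeSeparated {K : Set Plane} {C : Fin 4 → Set Plane} (hK : Convex ℝ K)
    (hC : ∀ i, Convex ℝ (C i)) (hne : ∀ i, (K ∩ C i).Nonempty)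
    (hd : ∀ i j, i ≠ j → Disjoint (C i) (C j)) (hop : OppositeSeparated K C) (k : Fin 4) :
    (HasSide K C k ∧ HasSide K C (k + 1)) ∨ (HasSide K C (k + 3) ∧ HasSide K C (k + 2)) := by
  obtain ⟨x, hx⟩ := hne k
  obtain ⟨y, hy⟩ := hne (k + 2)
  let g : ℝ →ᵃ[ℝ] Plane := AffineMap.lineMap (k := ℝ) x y
  have g0 : g 0 = x := AffineMap.lineMap_apply_zero x y
  have g1 : g 1 = y := AffineMap.lineMap_apply_one x y
  have hseg : ∀ a b, a ≤ b → segment ℝ (g a) (g b) = g '' Set.Icc a b := by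
    intro a b hab
    rw [← image_segment, segment_eq_Icc hab]
  have hord : ∀ {S : Set Plane}, Convex ℝ S → ∀ {a b t : ℝ}, a ≤ t → t ≤ b →
      g a ∈ S → g b ∈ S → g t ∈ S := by
    intro S hS a b t hat htb ha hb
    refine hS.segment_subset ha hb ?_
    rw [hseg a b (hat.trans htb)]
    exact ⟨t, ⟨hat, htb⟩, rfl⟩
  have hgK : ∀ t, 0 ≤ t → t ≤ 1 → g t ∈ K := fun t h0 h1 =>
    hord hK h0 h1 (g0 ▸ hx.1) (g1 ▸ hy.1)
  have hdis : ∀ {i j : Fin 4} {p : Plane}, p ∈ C i → p ∈ C j → i = j := by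
    intro i j p hi hj
    by_contra h
    exact Set.disjoint_left.1 (hd i j h) hi hj
  have hx0 : g 0 ∈ C k := g0 ▸ hx.2
  have hy1 : g 1 ∈ C (k + 2) := g1 ▸ hy.2
  have hcross : ∀ (l : Fin 4) (a b : ℝ), 0 ≤ a → a ≤ b → b ≤ 1 →
      (g a ∈ C l ∧ g b ∈ C (l + 2) ∨ g b ∈ C l ∧ g a ∈ C (l + 2)) →
      ∃ t, a ≤ t ∧ t ≤ b ∧ (g t ∈ C (l + 1) ∨ g t ∈ C (l + 3)) := by
    intro l a b ha hab hb h
    by_contra hcon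
    push Not at hcon
    have hsub : segment ℝ (g a) (g b) ⊆ K \ (C (l + 1) ∪ C (l + 3)) := by
      rw [hseg a b hab]
      rintro _ ⟨t, ht, rfl⟩
      refine ⟨hgK t (ha.trans ht.1) (ht.2.trans hb), ?_⟩
      rintro (h' | h')
      · exact (hcon t ht.1 ht.2).1 h'
      · exact (hcon t ht.1 ht.2).2 h'
    have hj := joinedIn_of_segment_subset hsub
    have haK := hgK a ha (hab.trans hb)
    have hbK := hgK b (ha.trans hab) hb
    rcases h with ⟨h1, h2⟩ | ⟨h1, h2⟩
    · exact hop l _ ⟨haK, h1⟩ _ ⟨hbK, h2⟩ hj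
    · exact hop l _ ⟨hbK, h1⟩ _ ⟨haK, h2⟩ hj.symm
  have hcase : ∀ e f : Fin 4, e ≠ f → e ≠ k → e ≠ k + 2 → f ≠ k → f ≠ k + 2 → ∀ s, 0 ≤ s → s ≤ 1 →
      g s ∈ C e → (∀ t, 0 ≤ t → t ≤ 1 → g t ∉ C f) →
      (Disjoint (segment ℝ x (g s)) (C (k + 2)) ∧ Disjoint (segment ℝ x (g s)) (C f)) ∧
      (Disjoint (segment ℝ (g s) y) (C k) ∧ Disjoint (segment ℝ (g s) y) (C f)) := by
    intro e f _ hek hek2 _ _ s hs0 hs1 hse hf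
    rw [← g0, ← g1, hseg 0 s hs0, hseg s 1 hs1]
    refine ⟨⟨?_, ?_⟩, ?_, ?_⟩ <;> rw [Set.disjoint_left] <;> rintro _ ⟨t, ht, rfl⟩ h
    · exact hek2 (hdis hse (hord (hC _) ht.2 hs1 h hy1))
    · exact hf t ht.1 (ht.2.trans hs1) h
    · exact hek (hdis hse (hord (hC _) hs0 ht.1 hx0 h))
    · exact hf t (hs0.trans ht.1) ht.2 h
  have hk1 := fin_four_add k
  have hne' := fin_four_add_ne k
  -- Between points of `C (k + 1)` and `C (k + 3)` the segment would meet `C k` or `C (k + 2)`.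
  -- Convexity of that set, which also contains an endpoint of the whole segment, would put one of
  -- the two points into it.
  have hboth : ∀ s t, 0 ≤ s → s ≤ 1 → 0 ≤ t → t ≤ 1 → g s ∈ C (k + 1) → g t ∉ C (k + 3) := by
    intro s t hs0 hs1 ht0 ht1 hs ht
    rcases le_total s t with hst | hst
    · obtain ⟨r, h1, h2, h3 | h3⟩ := hcross (k + 1) s t hs0 hst ht1 (Or.inl ⟨hs, hk1.2.1 ▸ ht⟩)
      · rw [hk1.1] at h3
        exact hne'.2.2.2.2 (hdis ht (hord (hC _) h2 ht1 h3 hy1))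
      · rw [hk1.2.2.1] at h3
        exact hne'.2.1 (hdis hs (hord (hC _) hs0 h1 hx0 h3))
    · obtain ⟨r, h1, h2, h3 | h3⟩ := hcross (k + 1) t s ht0 hst hs1 (Or.inr ⟨hs, hk1.2.1 ▸ ht⟩)
      · rw [hk1.1] at h3
        exact hne'.2.2.1 (hdis hs (hord (hC _) h2 hs1 h3 hy1))
      · rw [hk1.2.2.1] at h3
        exact hne'.2.2.2.1 (hdis ht (hord (hC _) ht0 h1 hx0 h3))
  obtain ⟨s, hs0, hs1, hs | hs⟩ := hcross k 0 1 le_rfl zero_le_one le_rfl (Or.inl ⟨hx0, hy1⟩)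
  · left
    obtain ⟨⟨h1, h2⟩, h3, h4⟩ := hcase (k + 1) (k + 3) hne'.1 hne'.2.1 hne'.2.2.1 hne'.2.2.2.1
      hne'.2.2.2.2 s hs0 hs1 hs fun t ht0 ht1 => hboth s t hs0 hs1 ht0 ht1 hs
    have hsK := hgK s hs0 hs1
    refine ⟨⟨x, hx, g s, ⟨hsK, hs⟩, h1, h2⟩, g s, ⟨hsK, hs⟩, y, ?_, ?_, ?_⟩
    · rw [hk1.1]; exact hy
    · rw [hk1.2.1]; exact h4
    · rw [hk1.2.2.1]; exact h3
  · right
    obtain ⟨⟨h1, h2⟩, h3, h4⟩ := hcase (k + 3) (k + 1) hne'.1.symm hne'.2.2.2.1 hne'.2.2.2.2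
      hne'.2.1 hne'.2.2.1 s hs0 hs1 hs fun t ht0 ht1 h => hboth t s ht0 ht1 hs0 hs1 h hs
    have hsK := hgK s hs0 hs1
    obtain ⟨-, -, -, e4, e5, e6, e7, e8, e9⟩ := hk1
    refine ⟨⟨g s, ⟨hsK, hs⟩, x, ?_, ?_, ?_⟩, y, hy, g s, ?_, ?_, ?_⟩
    · rw [e4]; exact hx
    · rw [e5, segment_symm]; exact h2
    · rw [e6, segment_symm]; exact h1
    · rw [e7]; exact ⟨hsK, hs⟩
    · rw [e8, segment_symm]; exact h3
    · rw [e9, segment_symm]; exact h4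

/-- Two points of `K ∩ L` cannot lie on two different sides of `K`, if `L` is disjoint from the
four sets that `K` meets. -/
theorem side_unique {K L : Set Plane} {C : Fin 4 → Set Plane} (hK : Convex ℝ K)
    (hL : Convex ℝ L) (hC : ∀ i, Convex ℝ (C i))
    (hLC : ∀ i, Disjoint L (C i)) (hop : OppositeSeparated K C) {i j : Fin 4} (hij : i ≠ j)
    {x y x' y' z z' : Plane} (hx : x ∈ K ∩ C i) (hy : y ∈ K ∩ C (i + 1))
    (h2 : Disjoint (segment ℝ x y) (C (i + 2))) (h3 : Disjoint (segment ℝ x y) (C (i + 3)))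
    (hx' : x' ∈ K ∩ C j) (hy' : y' ∈ K ∩ C (j + 1))
    (h2' : Disjoint (segment ℝ x' y') (C (j + 2))) (h3' : Disjoint (segment ℝ x' y') (C (j + 3)))
    (hz : z ∈ segment ℝ x y) (hzL : z ∈ L) (hz' : z' ∈ segment ℝ x' y') (hzL' : z' ∈ L) :
    False := by
  -- Each half of the side, from an endpoint to `z`, meets only the set of its own endpoint: if it
  -- met the set at the other end, convexity would put `z` into that set, although `z` lies in `L`.
  have key : ∀ {i : Fin 4} {x y z : Plane}, x ∈ K ∩ C i → y ∈ K ∩ C (i + 1) →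
      Disjoint (segment ℝ x y) (C (i + 2)) → Disjoint (segment ℝ x y) (C (i + 3)) →
      z ∈ segment ℝ x y → z ∈ L →
      (segment ℝ x z ⊆ K ∧ ∀ l, l ≠ i → Disjoint (segment ℝ x z) (C l)) ∧
      (segment ℝ y z ⊆ K ∧ ∀ l, l ≠ i + 1 → Disjoint (segment ℝ y z) (C l)) := by
    intro i x y z hx hy h2 h3 hz hzL
    have hzK : z ∈ K := hK.segment_subset hx.1 hy.1 hz
    have hcov : ∀ l : Fin 4, l = i ∨ l = i + 1 ∨ l = i + 2 ∨ l = i + 3 := by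
      clear * -
      revert i; decide
    have hsx : segment ℝ x z ⊆ segment ℝ x y :=
      (convex_segment x y).segment_subset (left_mem_segment ℝ x y) hz
    have hsy : segment ℝ y z ⊆ segment ℝ x y :=
      (convex_segment x y).segment_subset (right_mem_segment ℝ x y) hz
    have hw := mem_segment_iff_wbtw.1 hz
    refine ⟨⟨hK.segment_subset hx.1 hzK, fun l hl => ?_⟩, hK.segment_subset hy.1 hzK,
      fun l hl => ?_⟩
    · rcases hcov l with rfl | rfl | rfl | rfl
      · exact absurd rfl hl
      · rw [Set.disjoint_left]
        intro p hp hpC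
        have hp' := mem_segment_iff_wbtw.1 hp
        have : z ∈ segment ℝ p y := mem_segment_iff_wbtw.2 (hw.trans_left_right hp')
        exact Set.disjoint_left.1 (hLC _) hzL ((hC _).segment_subset hpC hy.2 this)
      · exact h2.mono_left hsx
      · exact h3.mono_left hsx
    · rcases hcov l with rfl | rfl | rfl | rfl
      · rw [Set.disjoint_left]
        intro p hp hpC
        have hp' := mem_segment_iff_wbtw.1 hp
        have : z ∈ segment ℝ p x := mem_segment_iff_wbtw.2 (hw.symm.trans_left_right hp')
        exact Set.disjoint_left.1 (hLC _) hzL ((hC _).segment_subset hpC hx.2 this)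
      · exact absurd rfl hl
      · exact h2.mono_left hsy
      · exact h3.mono_left hsy
  have hzK : z ∈ K := hK.segment_subset hx.1 hy.1 hz
  have hzK' : z' ∈ K := hK.segment_subset hx'.1 hy'.1 hz'
  have hmid : ∀ k, JoinedIn (K \ (C (k + 1) ∪ C (k + 3))) z z' := by
    intro k
    refine joinedIn_of_segment_subset fun p hp => ⟨hK.segment_subset hzK hzK' hp, ?_⟩
    have hpL : p ∈ L := hL.segment_subset hzL hzL' hp
    rintro (h | h)
    · exact Set.disjoint_left.1 (hLC _) hpL h
    · exact Set.disjoint_left.1 (hLC _) hpL h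
  have hpath : ∀ {x z : Plane} (k l : Fin 4), l ≠ k + 1 → l ≠ k + 3 →
      (segment ℝ x z ⊆ K ∧ ∀ m, m ≠ l → Disjoint (segment ℝ x z) (C m)) →
      JoinedIn (K \ (C (k + 1) ∪ C (k + 3))) x z := by
    intro x z k l hl1 hl3 h
    refine joinedIn_of_segment_subset fun p hp => ⟨h.1 hp, ?_⟩
    rintro (h' | h')
    · exact Set.disjoint_left.1 (h.2 _ hl1.symm) hp h'
    · exact Set.disjoint_left.1 (h.2 _ hl3.symm) hp h'
  obtain ⟨kx, ky⟩ := key hx hy h2 h3 hz hzL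
  obtain ⟨kx', ky'⟩ := key hx' hy' h2' h3' hz' hzL'
  have hij' : j = i + 1 ∨ j = i + 2 ∨ j = i + 3 := by
    clear * - hij
    revert i j; decide
  have hne : ∀ k : Fin 4, k ≠ k + 1 ∧ k ≠ k + 3 ∧ k + 2 ≠ k + 1 ∧ k + 2 ≠ k + 3 := by decide
  have hadd : i + 1 + 1 = i + 2 ∧ i + 1 + 2 = i + 3 := by
    clear * -
    revert i; decide
  -- For two different sides, some endpoint of one and some endpoint of the other lie in opposite
  -- sets.
  rcases hij' with rfl | rfl | rfl
  · rw [hadd.1] at hy' ky'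
    exact hop i x hx y' hy' (((hpath i i (hne i).1 (hne i).2.1 kx).trans (hmid i)).trans
      (hpath i (i + 2) (hne i).2.2.1 (hne i).2.2.2 ky').symm)
  · exact hop i x hx x' hx' (((hpath i i (hne i).1 (hne i).2.1 kx).trans (hmid i)).trans
      (hpath i (i + 2) (hne i).2.2.1 (hne i).2.2.2 kx').symm)
  · rw [← hadd.2] at hx' kx'
    exact hop (i + 1) y hy x' hx' (((hpath (i + 1) (i + 1) (hne _).1 (hne _).2.1 ky).trans
      (hmid _)).trans (hpath (i + 1) (i + 1 + 2) (hne _).2.2.1 (hne _).2.2.2 kx').symm)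

/-! ### Axis-parallel ellipses with integer data -/

/-- An axis-parallel ellipse with centre `(x, y)` and semi-axes `a`, `b`. -/
structure Oval where
  x : ℤ
  y : ℤ
  a : ℤ
  b : ℤ

namespace Oval

/-- The ellipse as a closed curve in the plane. -/
def curve (d : Oval) : Set Plane := {p | ellipseForm !₂[(d.x : ℝ), (d.y : ℝ)] 0 d.a d.b p = 1}

/-- A polynomial that is negative inside, zero on and positive outside the ellipse. -/
def power (d : Oval) (p : ℤ × ℤ) : ℤ :=
  (d.b * (p.1 - d.x)) ^ 2 + (d.a * (p.2 - d.y)) ^ 2 - (d.a * d.b) ^ 2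

/-- The four vertices of the ellipse. -/
def apices (d : Oval) : List (ℤ × ℤ) :=
  [(d.x + d.a, d.y), (d.x, d.y + d.b), (d.x - d.a, d.y), (d.x, d.y - d.b)]

/-- The four corners of the bounding box. -/
def corners (d : Oval) : List (ℤ × ℤ) :=
  [(d.x + d.a, d.y + d.b), (d.x + d.a, d.y - d.b), (d.x - d.a, d.y + d.b), (d.x - d.a, d.y - d.b)]

/-- The point of the bounding box of `d` that is nearest to the centre of `e`. -/
def nearest (d e : Oval) : ℤ × ℤ :=
  (max (d.x - d.a) (min e.x (d.x + d.a)), max (d.y - d.b) (min e.y (d.y + d.b)))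

/-- Some vertex of `d` is not outside `e`, and some vertex of `d` is not inside `e`. -/
def Crosses (d e : Oval) : Prop :=
  (∃ p ∈ d.apices, e.power p ≤ 0) ∧ ∃ p ∈ d.apices, 0 ≤ e.power p

/-- The bounding box of `d` is inside `e` or outside `e`. -/
def Avoids (d e : Oval) : Prop :=
  (∀ p ∈ d.corners, e.power p < 0) ∨ 0 < e.power (d.nearest e)

instance (d e : Oval) : Decidable (d.Crosses e) := by unfold Crosses; infer_instance

instance (d e : Oval) : Decidable (d.Avoids e) := by unfold Avoids; infer_instance

theorem mem_curve_iff {d : Oval} (ha : 0 < d.a) (hb : 0 < d.b) (p : Plane) :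
    p ∈ d.curve ↔
      ((d.b : ℝ) * (p 0 - d.x)) ^ 2 + ((d.a : ℝ) * (p 1 - d.y)) ^ 2 = ((d.a : ℝ) * d.b) ^ 2 := by
  have ha' : (d.a : ℝ) ≠ 0 := by exact_mod_cast ha.ne'
  have hb' : (d.b : ℝ) ≠ 0 := by exact_mod_cast hb.ne'
  simp only [curve, ellipseForm, Set.mem_ofPred_eq, Real.cos_zero, Real.sin_zero]
  simp only [Matrix.cons_val_zero, Matrix.cons_val_one, one_mul, zero_mul,
    add_zero, neg_zero, zero_add]
  rw [div_pow, div_pow, div_add_div _ _ (pow_ne_zero 2 ha') (pow_ne_zero 2 hb'),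
    div_eq_one_iff_eq (by positivity)]
  constructor <;> intro h <;> linear_combination h

theorem isEllipse_curve {d : Oval} (ha : 0 < d.a) (hb : 0 < d.b) : IsEllipse d.curve :=
  ⟨_, 0, d.a, d.b, by exact_mod_cast ha, by exact_mod_cast hb, rfl⟩

/-- The polynomial of `e` changes sign or vanishes along the connected curve `d`, so the
intermediate value theorem applies. -/
theorem inter_nonempty_of_crosses {d e : Oval} (hda : 0 < d.a) (hdb : 0 < d.b) (hea : 0 < e.a)
    (heb : 0 < e.b) (h : d.Crosses e) : (d.curve ∩ e.curve).Nonempty := by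
  let f : ℝ → ℝ := fun t =>
    ((e.b : ℝ) * (d.x + d.a * Real.cos t - e.x)) ^ 2 +
      ((e.a : ℝ) * (d.y + d.b * Real.sin t - e.y)) ^ 2 - ((e.a : ℝ) * e.b) ^ 2
  have hf : Continuous f := by fun_prop
  have hv : ∀ p ∈ d.apices, ∃ t, f t = (e.power p : ℤ) := by
    intro p hp
    simp only [apices, List.mem_cons, List.not_mem_nil, or_false] at hp
    rcases hp with rfl | rfl | rfl | rfl
    · exact ⟨0, by simp [f, power]⟩
    · exact ⟨Real.pi / 2, by simp [f, power]⟩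
    · exact ⟨Real.pi, by simp [f, power, sub_eq_add_neg]⟩
    · exact ⟨-(Real.pi / 2), by simp [f, power, sub_eq_add_neg]⟩
  obtain ⟨⟨p, hp, hp0⟩, q, hq, hq0⟩ := h
  obtain ⟨t, ht⟩ := hv p hp
  obtain ⟨s, hs⟩ := hv q hq
  have ht' : f t ≤ 0 := by rw [ht]; exact_mod_cast hp0
  have hs' : 0 ≤ f s := by rw [hs]; exact_mod_cast hq0
  obtain ⟨r, hr⟩ := mem_range_of_exists_le_of_exists_ge hf ⟨t, ht'⟩ ⟨s, hs'⟩
  refine ⟨!₂[(d.x : ℝ) + d.a * Real.cos r, (d.y : ℝ) + d.b * Real.sin r], ?_, ?_⟩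
  · rw [mem_curve_iff hda hdb]
    simp only [Matrix.cons_val_zero, Matrix.cons_val_one]
    linear_combination ((d.a : ℝ) * d.b) ^ 2 * Real.cos_sq_add_sin_sq r
  · rw [mem_curve_iff hea heb]
    simp only [Matrix.cons_val_zero, Matrix.cons_val_one]
    simp only [f] at hr
    linarith

theorem abs_sub_le_of_mem_curve {d : Oval} (ha : 0 < d.a) (hb : 0 < d.b) {p : Plane}
    (hp : p ∈ d.curve) : |p 0 - d.x| ≤ d.a ∧ |p 1 - d.y| ≤ d.b := by
  have ha' : (0 : ℝ) < d.a := by exact_mod_cast ha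
  have hb' : (0 : ℝ) < d.b := by exact_mod_cast hb
  rw [mem_curve_iff ha hb] at hp
  constructor
  · have h : ((d.b : ℝ) * (p 0 - d.x)) ^ 2 ≤ ((d.b : ℝ) * d.a) ^ 2 := by
      nlinarith [sq_nonneg ((d.a : ℝ) * (p 1 - d.y))]
    have := abs_le_of_sq_le_sq h (by positivity)
    rw [abs_mul, abs_of_pos hb'] at this
    exact le_of_mul_le_mul_left this hb'
  · have h : ((d.a : ℝ) * (p 1 - d.y)) ^ 2 ≤ ((d.a : ℝ) * d.b) ^ 2 := by
      nlinarith [sq_nonneg ((d.b : ℝ) * (p 0 - d.x))]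
    have := abs_le_of_sq_le_sq h (by positivity)
    rw [abs_mul, abs_of_pos ha'] at this
    exact le_of_mul_le_mul_left this ha'

theorem sq_sub_le_max {c a x y : ℝ} (h : |x - c| ≤ a) :
    (x - y) ^ 2 ≤ (c + a - y) ^ 2 ∨ (x - y) ^ 2 ≤ (c - a - y) ^ 2 := by
  rw [abs_le] at h
  rcases le_total y x with hxy | hxy
  · left; exact pow_le_pow_left₀ (by linarith) (by linarith) 2
  · right
    rw [← neg_sq (x - y), ← neg_sq (c - a - y)]
    exact pow_le_pow_left₀ (by linarith) (by linarith) 2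

theorem sq_clamp_sub_le {c a x y : ℝ} (h : |x - c| ≤ a) :
    (max (c - a) (min y (c + a)) - y) ^ 2 ≤ (x - y) ^ 2 := by
  rw [abs_le] at h
  rw [sq_le_sq]
  rcases le_total y (c + a) with h1 | h1
  · rw [min_eq_left h1]
    rcases le_total (c - a) y with h2 | h2
    · rw [max_eq_right h2]; simp
    · rw [max_eq_left h2, abs_of_nonneg (by linarith), abs_of_nonneg (by linarith)]; linarith
  · rw [min_eq_right h1, max_eq_right (by linarith), abs_of_nonpos (by linarith),
      abs_of_nonpos (by linarith)]
    linarith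

/-- Since `e` is axis-parallel, its polynomial separates into the two coordinates. On a box it is
therefore largest at a corner and smallest at the coordinatewise clamp of the centre. -/
theorem disjoint_of_avoids {d e : Oval} (hda : 0 < d.a) (hdb : 0 < d.b) (hea : 0 < e.a)
    (heb : 0 < e.b) (h : d.Avoids e) : Disjoint d.curve e.curve := by
  rw [Set.disjoint_left]
  intro p hpd hpe
  obtain ⟨hx, hy⟩ := abs_sub_le_of_mem_curve hda hdb hpd
  rw [mem_curve_iff hea heb, mul_pow, mul_pow] at hpe
  have hB : (0 : ℝ) ≤ (e.b : ℝ) ^ 2 := sq_nonneg _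
  have hA : (0 : ℝ) ≤ (e.a : ℝ) ^ 2 := sq_nonneg _
  rcases h with h | h
  · have hc : ∀ q ∈ d.corners, (e.b : ℝ) ^ 2 * ((q.1 : ℝ) - e.x) ^ 2 +
        (e.a : ℝ) ^ 2 * ((q.2 : ℝ) - e.y) ^ 2 < ((e.a : ℝ) * e.b) ^ 2 := by
      intro q hq
      have h1 : ((e.power q : ℤ) : ℝ) < 0 := by exact_mod_cast h q hq
      simp only [power] at h1
      push_cast at h1
      linarith
    simp only [corners, List.forall_mem_cons, List.not_mem_nil, false_imp_iff, implies_true,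
      and_true] at hc
    push_cast at hc
    obtain ⟨c1, c2, c3, c4⟩ := hc
    rcases sq_sub_le_max (y := (e.x : ℝ)) hx with h1 | h1 <;>
    rcases sq_sub_le_max (y := (e.y : ℝ)) hy with h2 | h2 <;>
    · have m1 := mul_le_mul_of_nonneg_left h1 hB
      have m2 := mul_le_mul_of_nonneg_left h2 hA
      linarith
  · have h1 : (0 : ℝ) < ((e.power (d.nearest e) : ℤ) : ℝ) := by exact_mod_cast h
    simp only [power, nearest] at h1
    push_cast at h1
    have m1 := mul_le_mul_of_nonneg_left (sq_clamp_sub_le (y := (e.x : ℝ)) hx) hB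
    have m2 := mul_le_mul_of_nonneg_left (sq_clamp_sub_le (y := (e.y : ℝ)) hy) hA
    rw [mul_pow, mul_pow] at h1
    linarith

end Oval

/-! ### The graph -/

/-- The 28 ellipses: two bodies crossing in four points, a hub in the centre and one around
everything, four chains of ellipses from hub to hub that cross the two bodies, and four circles
linking consecutive chains. -/
def ovals : Fin 28 → Oval :=
  ![⟨25, 0, 3, 3⟩, ⟨0, 11, 3, 3⟩, ⟨-25, 0, 3, 3⟩, ⟨0, -11, 3, 3⟩,
    ⟨11, 0, 3, 3⟩, ⟨0, 25, 3, 3⟩, ⟨-11, 0, 3, 3⟩, ⟨0, -25, 3, 3⟩,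
    ⟨40, 0, 13, 1⟩, ⟨0, 6, 3, 3⟩, ⟨-40, 0, 13, 1⟩, ⟨0, -6, 3, 3⟩,
    ⟨6, 0, 3, 3⟩, ⟨0, 40, 1, 13⟩, ⟨-6, 0, 3, 3⟩, ⟨0, -40, 1, 13⟩,
    ⟨18, 0, 5, 4⟩, ⟨0, 18, 4, 5⟩, ⟨-18, 0, 5, 4⟩, ⟨0, -18, 4, 5⟩,
    ⟨18, 18, 15, 15⟩, ⟨-18, 18, 15, 15⟩, ⟨-18, -18, 15, 15⟩, ⟨18, -18, 15, 15⟩,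
    ⟨0, 0, 4, 4⟩, ⟨0, 0, 50, 50⟩, ⟨0, 0, 25, 11⟩, ⟨0, 0, 11, 25⟩]

/-- The intersection graph of the curves `ovals`. -/
def ovalGraph : SimpleGraph (Fin 28) where
  Adj u v := u ≠ v ∧ ((ovals u).Crosses (ovals v) ∨ (ovals v).Crosses (ovals u))
  symm := ⟨fun _ _ h => ⟨h.1.symm, h.2.symm⟩⟩
  loopless := ⟨fun _ h => h.1 rfl⟩

instance : DecidableRel ovalGraph.Adj := fun u v => by
  unfold ovalGraph; dsimp only; infer_instance

theorem ovals_pos : ∀ v, 0 < (ovals v).a ∧ 0 < (ovals v).b := by decide +kernel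

/-- The integer tests `Crosses` and `Avoids` settle every pair, so adjacency in `ovalGraph` is
exactly intersection of the curves. -/
theorem ovals_crosses_or_avoids : ∀ u v, u ≠ v → ovalGraph.Adj u v ∨
    (ovals u).Avoids (ovals v) ∨ (ovals v).Avoids (ovals u) := by decide +kernel

theorem ovalGraph_hasIntersectionRepresentation :
    HasIntersectionRepresentation ovalGraph IsEllipse := by
  refine ⟨fun v => (ovals v).curve, fun v => Oval.isEllipse_curve (ovals_pos v).1 (ovals_pos v).2,
    fun u v huv => ?_⟩
  obtain ⟨hua, hub⟩ := ovals_pos u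
  obtain ⟨hva, hvb⟩ := ovals_pos v
  constructor
  · rintro ⟨-, h | h⟩
    · exact Oval.inter_nonempty_of_crosses hua hub hva hvb h
    · rw [Set.inter_comm]
      exact Oval.inter_nonempty_of_crosses hva hvb hua hub h
  · intro h
    rcases ovals_crosses_or_avoids u v huv with h' | h' | h'
    · exact h'
    · exact absurd (Oval.disjoint_of_avoids hua hub hva hvb h')
        (Set.not_disjoint_iff_nonempty_inter.2 h)
    · exact absurd (Oval.disjoint_of_avoids hva hvb hua hub h').symm
        (Set.not_disjoint_iff_nonempty_inter.2 h)

/-! ### There is no representation by convex sets -/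

section Convex

variable {V : Type*} {G : SimpleGraph V} {R : V → Set Plane}

/-- The union of the representatives of the vertices in a list. -/
def unionOf (R : V → Set Plane) (l : List V) : Set Plane := ⋃ v ∈ l, R v

theorem subset_unionOf {l : List V} {v : V} (hv : v ∈ l) : R v ⊆ unionOf R l :=
  Set.subset_biUnion_of_mem (u := R) (show v ∈ {w | w ∈ l} from hv)

theorem joinedIn_unionOf (hR : ∀ v, Convex ℝ (R v))
    (hG : ∀ u v, u ≠ v → (G.Adj u v ↔ (R u ∩ R v).Nonempty)) {l : List V}
    (hl : l.IsChain G.Adj) {u v : V} (hu : u ∈ l) (hv : v ∈ l) {x y : Plane} (hx : x ∈ R u)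
    (hy : y ∈ R v) : JoinedIn (unionOf R l) x y := by
  have hself : ∀ {l : List V} {w : V} {p q : Plane}, w ∈ l → p ∈ R w → q ∈ R w →
      JoinedIn (unionOf R l) p q := fun hw hp hq =>
    joinedIn_of_segment_subset (((hR _).segment_subset hp hq).trans (subset_unionOf hw))
  have hhead : ∀ (l : List V) (w : V), (w :: l).IsChain G.Adj → ∀ z ∈ w :: l, ∀ p ∈ R w,
      ∀ q ∈ R z, JoinedIn (unionOf R (w :: l)) p q := by
    intro l
    induction l with
    | nil =>
      intro w _ z hz p hp q hq
      obtain rfl : z = w := by simpa using hz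
      exact hself List.mem_cons_self hp hq
    | cons w' l ih =>
      intro w hw z hz p hp q hq
      rcases List.mem_cons.1 hz with rfl | hz
      · exact hself List.mem_cons_self hp hq
      · rw [List.isChain_cons_cons] at hw
        obtain ⟨r, hr, hr'⟩ := (hG w w' hw.1.ne).1 hw.1
        refine (hself List.mem_cons_self hp hr).trans ((ih w' hw.2 z hz r hr' q hq).mono ?_)
        exact Set.biUnion_subset_biUnion_left fun a ha => List.mem_cons_of_mem w ha
  cases l with
  | nil => exact absurd hu List.not_mem_nil
  | cons w l =>
    obtain ⟨r, hr⟩ : (R w).Nonempty := by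
      cases l with
      | nil =>
        obtain rfl : u = w := by simpa using hu
        exact ⟨x, hx⟩
      | cons w' l =>
        rw [List.isChain_cons_cons] at hl
        exact ((hG w w' hl.1.ne).1 hl.1).mono Set.inter_subset_left
    exact (hhead l w hl u hu r hr x hx).symm.trans (hhead l w hl v hv r hr y hy)

/-- A drawing of `K₃,₃` whose edges are walks `W i j`, or, if `W i j` is empty, sets `T i j`. -/
theorem no_K33_of_walks (hR : ∀ v, Convex ℝ (R v))
    (hG : ∀ u v, u ≠ v → (G.Adj u v ↔ (R u ∩ R v).Nonempty)) (W : Fin 3 → Fin 3 → List V)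
    (T : Fin 3 → Fin 3 → Set Plane) (P Q : Fin 3 → V) (A B : Fin 3 → Plane)
    (hA : ∀ i, A i ∈ R (P i)) (hB : ∀ j, B j ∈ R (Q j))
    (hW : ∀ i j, W i j ≠ [] → (W i j).IsChain G.Adj ∧ P i ∈ W i j ∧ Q j ∈ W i j)
    (hT : ∀ i j, W i j = [] → JoinedIn (T i j) (A i) (B j))
    (hWW : ∀ i j k l, i ≠ k → j ≠ l → ∀ u ∈ W i j, ∀ v ∈ W k l, u ≠ v ∧ ¬ G.Adj u v)
    (hTW : ∀ i j k l, i ≠ k → j ≠ l → W i j = [] → ∀ v ∈ W k l, Disjoint (T i j) (R v))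
    (hTT : ∀ i j k l, i ≠ k → j ≠ l → W i j = [] → W k l = [] → Disjoint (T i j) (T k l)) :
    False := by
  classical
  have hTW' : ∀ i j k l, i ≠ k → j ≠ l → W i j = [] →
      Disjoint (T i j) (unionOf R (W k l)) := by
    intro i j k l hik hjl h
    exact Set.disjoint_iUnion₂_right.2 fun v hv => hTW i j k l hik hjl h v hv
  refine no_planar_drawing_K33_sets A B
    (fun i j => if W i j = [] then T i j else unionOf R (W i j)) (fun i j => ?_)
    fun i j k l hik hjl => ?_
  · split_ifs with h
    · exact hT i j h
    · exact joinedIn_unionOf hR hG (hW i j h).1 (hW i j h).2.1 (hW i j h).2.2 (hA i) (hB j)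
  · have hik := hik.ne
    split_ifs with h h' h'
    · exact hTT i j k l hik hjl h h'
    · exact hTW' i j k l hik hjl h
    · exact (hTW' k l i j hik.symm hjl.symm h').symm
    · refine Set.disjoint_iUnion₂_left.2 fun u hu => Set.disjoint_iUnion₂_right.2 fun v hv => ?_
      obtain ⟨hne, hn⟩ := hWW i j k l hik hjl u hu v hv
      rw [hG u v hne, Set.not_nonempty_iff_eq_empty] at hn
      exact Set.disjoint_iff_inter_eq_empty.2 hn

end Convex

/-! ### Names for the ellipses, walks of the `K₃,₃` drawings and their finite checks -/

/-- The ellipse of the `i`-th chain that crosses the body `z`. -/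
def touch (z : Fin 2) (i : Fin 4) : Fin 28 := ⟨4 * z + i, by omega⟩

/-- The ellipse that joins `touch z i` to a hub. -/
def link (z : Fin 2) (i : Fin 4) : Fin 28 := ⟨8 + 4 * z + i, by omega⟩

/-- The ellipse in the middle of the `i`-th chain. -/
def mid (i : Fin 4) : Fin 28 := ⟨16 + i, by omega⟩

/-- The circle that joins the chains `i` and `i + 1`. -/
def tie (i : Fin 4) : Fin 28 := ⟨20 + i, by omega⟩

/-- The hub that is joined to `touch z i` by `link z i`. -/
def hub (z : Fin 2) (i : Fin 4) : Fin 28 := ⟨24 + (i + 1 + z) % 2, by omega⟩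

/-- The two bodies. -/
def body (z : Fin 2) : Fin 28 := ⟨26 + z, by omega⟩

/-- The walks of a `K₃,₃` that uses a path of the body `z` from chain `k` to chain `k + 2`. -/
def oppositeWalk (z : Fin 2) (k : Fin 4) : Fin 3 → Fin 3 → List (Fin 28) :=
  ![![[hub z k, link z k, touch z k],
      [hub z k, link (z + 1) (k + 1), touch (z + 1) (k + 1), mid (k + 1)],
      [hub z k, link (z + 1) (k + 3), touch (z + 1) (k + 3), mid (k + 3)]],
    ![[hub (z + 1) k, link (z + 1) k, touch (z + 1) k, mid k, touch z k],
      [hub (z + 1) k, link z (k + 1), touch z (k + 1), mid (k + 1)],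
      [hub (z + 1) k, link z (k + 3), touch z (k + 3), mid (k + 3)]],
    ![[],
      [touch z (k + 2), mid (k + 2), tie (k + 1), mid (k + 1)],
      [touch z (k + 2), mid (k + 2), tie (k + 2), mid (k + 3)]]]

/-- The walks of a `K₃,₃` that uses paths of both bodies from chain `i` to chain `i + 1`. -/
def crossingWalk (i : Fin 4) : Fin 3 → Fin 3 → List (Fin 28) :=
  ![![[hub 1 i, link 1 i, touch 1 i],
      [hub 1 i, link 1 (i + 2), touch 1 (i + 2), mid (i + 2), touch 0 (i + 2), link 0 (i + 2),
        hub 0 i],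
      [hub 1 i, link 0 (i + 1), touch 0 (i + 1)]],
    ![[touch 0 i, mid i, touch 1 i], [touch 0 i, link 0 i, hub 0 i], []],
    ![[], [touch 1 (i + 1), link 1 (i + 1), hub 0 i],
      [touch 1 (i + 1), mid (i + 1), touch 0 (i + 1)]]]

theorem oppositeWalk_chain : ∀ z k i j, oppositeWalk z k i j ≠ [] →
    (oppositeWalk z k i j).IsChain ovalGraph.Adj ∧
      ![hub z k, hub (z + 1) k, touch z (k + 2)] i ∈ oppositeWalk z k i j ∧
      ![touch z k, mid (k + 1), mid (k + 3)] j ∈ oppositeWalk z k i j := by decide +kernel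

theorem oppositeWalk_indep : ∀ z k i j k' l, i ≠ k' → j ≠ l → ∀ u ∈ oppositeWalk z k i j,
    ∀ v ∈ oppositeWalk z k k' l, u ≠ v ∧ ¬ ovalGraph.Adj u v := by decide +kernel

theorem oppositeWalk_empty : ∀ z k i j, oppositeWalk z k i j = [] → i = 2 ∧ j = 0 := by
  decide +kernel

theorem oppositeWalk_body : ∀ z k i j, 2 ≠ i → 0 ≠ j → ∀ v ∈ oppositeWalk z k i j,
    (body z ≠ v ∧ ¬ ovalGraph.Adj (body z) v) ∨ v = touch z (k + 1) ∨ v = touch z (k + 3) := by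
  decide +kernel

theorem crossingWalk_chain : ∀ k i j, crossingWalk k i j ≠ [] →
    (crossingWalk k i j).IsChain ovalGraph.Adj ∧
      ![hub 1 k, touch 0 k, touch 1 (k + 1)] i ∈ crossingWalk k i j ∧
      ![touch 1 k, hub 0 k, touch 0 (k + 1)] j ∈ crossingWalk k i j := by decide +kernel

theorem crossingWalk_indep : ∀ k i j k' l, i ≠ k' → j ≠ l → ∀ u ∈ crossingWalk k i j,
    ∀ v ∈ crossingWalk k k' l, u ≠ v ∧ ¬ ovalGraph.Adj u v := by decide +kernel

theorem crossingWalk_empty : ∀ k i j, crossingWalk k i j = [] →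
    (i = 1 ∧ j = 2) ∨ (i = 2 ∧ j = 0) := by decide +kernel

theorem crossingWalk_body_zero : ∀ k i j, 1 ≠ i → 2 ≠ j → ∀ v ∈ crossingWalk k i j,
    (body 0 ≠ v ∧ ¬ ovalGraph.Adj (body 0) v) ∨ v = touch 0 (k + 2) := by decide +kernel

theorem crossingWalk_body_one : ∀ k i j, 2 ≠ i → 0 ≠ j → ∀ v ∈ crossingWalk k i j,
    (body 1 ≠ v ∧ ¬ ovalGraph.Adj (body 1) v) ∨ v = touch 1 (k + 2) := by decide +kernel

theorem body_adj_touch : ∀ z i, ovalGraph.Adj (body z) (touch z i) := by decide +kernel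

theorem hub_adj_link : ∀ z i, ovalGraph.Adj (hub z i) (link z i) := by decide +kernel

theorem mid_adj_touch : ∀ z i, ovalGraph.Adj (mid i) (touch z i) := by decide +kernel

theorem touch_indep : ∀ z i j, i ≠ j →
    touch z i ≠ touch z j ∧ ¬ ovalGraph.Adj (touch z i) (touch z j) := by decide +kernel

theorem body_one_touch_zero : ∀ i,
    body 1 ≠ touch 0 i ∧ ¬ ovalGraph.Adj (body 1) (touch 0 i) := by decide +kernel

/-! ### Representations of the graph of ovals by convex sets -/

section OvalRepresentation

variable {R : Fin 28 → Set Plane}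

theorem disjoint_of_not_adj (hG : ∀ u v, u ≠ v → (ovalGraph.Adj u v ↔ (R u ∩ R v).Nonempty))
    {u v : Fin 28} (h : u ≠ v ∧ ¬ ovalGraph.Adj u v) : Disjoint (R u) (R v) := by
  have h' := h.2
  rw [hG u v h.1, Set.not_nonempty_iff_eq_empty] at h'
  exact Set.disjoint_iff_inter_eq_empty.2 h'

theorem nonempty_of_adj (hG : ∀ u v, u ≠ v → (ovalGraph.Adj u v ↔ (R u ∩ R v).Nonempty))
    {u v : Fin 28} (h : ovalGraph.Adj u v) : (R u ∩ R v).Nonempty := (hG _ _ h.ne).1 h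

/-- The parts of the `K₃,₃` are the two hubs with `touch z (k + 2)`, and `touch z k` with `mid (k +
1)` and `mid (k + 3)`. The forbidden path would be the one edge that `oppositeWalk` leaves empty. -/
theorem oppositeSeparated_body (hR : ∀ v, Convex ℝ (R v))
    (hG : ∀ u v, u ≠ v → (ovalGraph.Adj u v ↔ (R u ∩ R v).Nonempty)) (z : Fin 2) :
    OppositeSeparated (R (body z)) fun i => R (touch z i) := by
  intro k x hx y hy hj
  obtain ⟨a, ha, -⟩ := nonempty_of_adj hG (hub_adj_link z k)
  obtain ⟨a', ha', -⟩ := nonempty_of_adj hG (hub_adj_link (z + 1) k)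
  obtain ⟨b, hb, -⟩ := nonempty_of_adj hG (mid_adj_touch z (k + 1))
  obtain ⟨b', hb', -⟩ := nonempty_of_adj hG (mid_adj_touch z (k + 3))
  refine no_K33_of_walks hR hG (oppositeWalk z k)
    (fun _ _ => R (body z) \ (R (touch z (k + 1)) ∪ R (touch z (k + 3))))
    _ _ ![a, a', y] ![x, b, b'] ?_ ?_ (oppositeWalk_chain z k) ?_ (oppositeWalk_indep z k) ?_ ?_
  · intro i; fin_cases i; exacts [ha, ha', hy.2]
  · intro i; fin_cases i; exacts [hx.2, hb, hb']
  · intro i j h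
    obtain ⟨rfl, rfl⟩ := oppositeWalk_empty z k i j h
    exact hj.symm
  · intro i j i' j' hi hj' h v hv
    obtain ⟨rfl, rfl⟩ := oppositeWalk_empty z k i j h
    rcases oppositeWalk_body z k i' j' hi hj' v hv with h' | rfl | rfl
    · exact (disjoint_of_not_adj hG h').mono_left Set.sdiff_subset
    · exact Set.disjoint_sdiff_left.mono_right Set.subset_union_left
    · exact Set.disjoint_sdiff_left.mono_right Set.subset_union_right
  · intro i j i' j' hi _ h h'
    exact absurd ((oppositeWalk_empty z k i j h).1.trans (oppositeWalk_empty z k i' j' h').1.symm)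
      hi

/-- Otherwise the two side segments would be disjoint and fill the two empty entries of
`crossingWalk`. The parts of that `K₃,₃` are `hub 1 i`, `touch 0 i`, `touch 1 (i + 1)` and `touch 1
i`, `hub 0 i`, `touch 0 (i + 1)`. -/
theorem exists_crossing (hR : ∀ v, Convex ℝ (R v))
    (hG : ∀ u v, u ≠ v → (ovalGraph.Adj u v ↔ (R u ∩ R v).Nonempty)) (i : Fin 4)
    (h : HasSide (R (body 0)) (fun i => R (touch 0 i)) i)
    (h' : HasSide (R (body 1)) (fun i => R (touch 1 i)) i) :
    ∃ x ∈ R (body 0) ∩ R (touch 0 i), ∃ y ∈ R (body 0) ∩ R (touch 0 (i + 1)),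
      Disjoint (segment ℝ x y) (R (touch 0 (i + 2))) ∧
      Disjoint (segment ℝ x y) (R (touch 0 (i + 3))) ∧ ∃ z ∈ segment ℝ x y, z ∈ R (body 1) := by
  obtain ⟨x, hx, y, hy, h2, h3⟩ := h
  obtain ⟨x', hx', y', hy', h2', -⟩ := h'
  refine ⟨x, hx, y, hy, h2, h3, ?_⟩
  by_contra hcon
  push Not at hcon
  obtain ⟨a, ha, -⟩ := nonempty_of_adj hG (hub_adj_link 1 i)
  obtain ⟨b, hb, -⟩ := nonempty_of_adj hG (hub_adj_link 0 i)
  have hxy := (hR (body 0)).segment_subset hx.1 hy.1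
  have hxy' : segment ℝ y' x' ⊆ R (body 1) := (hR (body 1)).segment_subset hy'.1 hx'.1
  rw [segment_symm] at h2'
  have hd : Disjoint (segment ℝ x y) (segment ℝ y' x') :=
    Set.disjoint_left.2 fun p hp hp' => hcon p hp (hxy' hp')
  refine no_K33_of_walks hR hG (crossingWalk i)
    -- The empty entries are (1, 2) and (2, 0), so the row alone tells which body supplies the edge.
    (fun k _ => if k = 1 then segment ℝ x y else segment ℝ y' x')
    _ _ ![a, x, y'] ![x', b, y] ?_ ?_ (crossingWalk_chain i) ?_ (crossingWalk_indep i) ?_ ?_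
  · intro i; fin_cases i; exacts [ha, hx.2, hy'.2]
  · intro i; fin_cases i; exacts [hx'.2, hb, hy.2]
  · intro k j h
    rcases crossingWalk_empty i k j h with ⟨rfl, rfl⟩ | ⟨rfl, rfl⟩
    · exact joinedIn_of_segment_subset subset_rfl
    · exact joinedIn_of_segment_subset subset_rfl
  · intro k j k' j' hk hj h v hv
    rcases crossingWalk_empty i k j h with ⟨rfl, rfl⟩ | ⟨rfl, rfl⟩
    · rcases crossingWalk_body_zero i k' j' hk hj v hv with h' | rfl
      · exact (disjoint_of_not_adj hG h').mono_left hxy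
      · exact h2
    · rcases crossingWalk_body_one i k' j' hk hj v hv with h' | rfl
      · exact (disjoint_of_not_adj hG h').mono_left hxy'
      · exact h2'
  · intro k j k' j' hk hj h h'
    rcases crossingWalk_empty i k j h with ⟨rfl, rfl⟩ | ⟨rfl, rfl⟩ <;>
    rcases crossingWalk_empty i k' j' h' with ⟨rfl, rfl⟩ | ⟨rfl, rfl⟩
    · exact absurd rfl hk
    · exact hd
    · exact hd.symm
    · exact absurd rfl hk

theorem common_side_unique (hR : ∀ v, Convex ℝ (R v))
    (hG : ∀ u v, u ≠ v → (ovalGraph.Adj u v ↔ (R u ∩ R v).Nonempty)) {i j : Fin 4}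
    (h : ∀ z, HasSide (R (body z)) (fun i => R (touch z i)) i)
    (h' : ∀ z, HasSide (R (body z)) (fun i => R (touch z i)) j) : i = j := by
  by_contra hij
  obtain ⟨x, hx, y, hy, h2, h3, z, hz, hzL⟩ := exists_crossing hR hG i (h 0) (h 1)
  obtain ⟨x', hx', y', hy', h2', h3', z', hz', hzL'⟩ := exists_crossing hR hG j (h' 0) (h' 1)
  exact side_unique (hR (body 0)) (hR (body 1)) (C := fun i => R (touch 0 i))
    (fun i => hR (touch 0 i)) (fun i => disjoint_of_not_adj hG (body_one_touch_zero i))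
    (oppositeSeparated_body hR hG 0) hij hx hy h2 h3 hx' hy' h2' h3' hz hzL hz' hzL'

end OvalRepresentation

/-! ### Counting common sides, and the conclusion -/

/-- The cases `k = 0` and `k = 1` already make each of `p` and `q` true at three or more of the four
indices, and two such subsets share at least two elements. -/
theorem two_common_sides : ∀ p q : Fin 4 → Bool,
    (∀ k, (p k ∧ p (k + 1)) ∨ (p (k + 3) ∧ p (k + 2))) →
    (∀ k, (q k ∧ q (k + 1)) ∨ (q (k + 3) ∧ q (k + 2))) →
    ∃ i j, i ≠ j ∧ p i ∧ q i ∧ p j ∧ q j := by decide +kernel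

theorem ovalGraph_no_convex_representation :
    ¬ HasIntersectionRepresentation ovalGraph fun S => Convex ℝ S := by
  classical
  rintro ⟨R, hR, hG⟩
  let p (z : Fin 2) (i : Fin 4) : Bool := decide (HasSide (R (body z)) (fun i => R (touch z i)) i)
  have hp : ∀ z i, p z i = true ↔ HasSide (R (body z)) (fun i => R (touch z i)) i :=
    fun z i => decide_eq_true_iff
  have hsides : ∀ z k, (p z k ∧ p z (k + 1)) ∨ (p z (k + 3) ∧ p z (k + 2)) := by
    intro z k
    simp only [hp]
    exact sides_of_oppositeSeparated (hR (body z)) (fun i => hR (touch z i))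
      (fun i => nonempty_of_adj hG (body_adj_touch z i))
      (fun i j hij => disjoint_of_not_adj hG (touch_indep z i j hij))
      (oppositeSeparated_body hR hG z) k
  obtain ⟨i, j, hij, hi, hi', hj, hj'⟩ := two_common_sides (p 0) (p 1) (hsides 0) (hsides 1)
  rw [hp] at hi hi' hj hj'
  exact hij (common_side_unique hR hG (Fin.forall_fin_two.2 ⟨hi, hi'⟩)
    (Fin.forall_fin_two.2 ⟨hj, hj'⟩))

/-- A filled ellipse is convex. -/
theorem IsFilledEllipse.convex {S : Set Plane} (h : IsFilledEllipse S) : Convex ℝ S := by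
  obtain ⟨c, θ, a, b, -, -, rfl⟩ := h
  have hsq : ∀ s t x y : ℝ, 0 ≤ s → 0 ≤ t → s + t = 1 →
      (s * x + t * y) ^ 2 ≤ s * x ^ 2 + t * y ^ 2 := by
    intro s t x y hs ht hst
    obtain rfl : t = 1 - s := by linarith
    nlinarith [mul_nonneg (mul_nonneg hs ht) (sq_nonneg (x - y))]
  intro p hp q hq s t hs ht hst
  simp only [ellipseForm, Set.mem_ofPred_eq] at hp hq ⊢
  have h1 := hsq s t ((Real.cos θ * (p 0 - c 0) + Real.sin θ * (p 1 - c 1)) / a)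
    ((Real.cos θ * (q 0 - c 0) + Real.sin θ * (q 1 - c 1)) / a) hs ht hst
  have h2 := hsq s t ((-Real.sin θ * (p 0 - c 0) + Real.cos θ * (p 1 - c 1)) / b)
    ((-Real.sin θ * (q 0 - c 0) + Real.cos θ * (q 1 - c 1)) / b) hs ht hst
  have e : ∀ (i : Fin 2), (s • p + t • q) i - c i = s * (p i - c i) + t * (q i - c i) := by
    intro i
    simp only [PiLp.add_apply, PiLp.smul_apply, smul_eq_mul]
    linear_combination (c i) * hst
  rw [e 0, e 1]
  have e1 : (Real.cos θ * (s * (p 0 - c 0) + t * (q 0 - c 0)) +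
      Real.sin θ * (s * (p 1 - c 1) + t * (q 1 - c 1))) / a =
      s * ((Real.cos θ * (p 0 - c 0) + Real.sin θ * (p 1 - c 1)) / a) +
      t * ((Real.cos θ * (q 0 - c 0) + Real.sin θ * (q 1 - c 1)) / a) := by ring
  have e2 : (-Real.sin θ * (s * (p 0 - c 0) + t * (q 0 - c 0)) +
      Real.cos θ * (s * (p 1 - c 1) + t * (q 1 - c 1))) / b =
      s * ((-Real.sin θ * (p 0 - c 0) + Real.cos θ * (p 1 - c 1)) / b) +
      t * ((-Real.sin θ * (q 0 - c 0) + Real.cos θ * (q 1 - c 1)) / b) := by ring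
  rw [e1, e2]
  nlinarith [mul_le_mul_of_nonneg_left hp hs, mul_le_mul_of_nonneg_left hq ht]

theorem mainTheorem12 :
    ∃ (n : ℕ) (G : SimpleGraph (Fin n)),
      HasIntersectionRepresentation G IsEllipse ∧
      ¬ HasIntersectionRepresentation G (fun S => Convex ℝ S) ∧
      ¬ HasIntersectionRepresentation G IsFilledEllipse :=
  ⟨28, ovalGraph, ovalGraph_hasIntersectionRepresentation, ovalGraph_no_convex_representation,
    fun ⟨R, hR, hG⟩ => ovalGraph_no_convex_representation ⟨R, fun v => (hR v).convex, hG⟩⟩
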